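/- Let $q$ be a power of $2$, and let $\mathbb F_q\subset\mathbb F_{q^3}\subset\mathbb F_{q^6}$ be the finite fields with $q$, $q^3$ and $q^6$ elements. For $b\in\mathbb F_{q^6}$ let \[U_b=\{(x,\,bx^{q}+x^{q^4}) : x\in\mathbb F_{q^6}\},\] an $\mathbb F_q$-subspace of $\mathbb F_{q^6}\times\mathbb F_{q^6}$. An $\mathbb F_q$-subspace $U$ of $\mathbb F_{q^6}\times\mathbb F_{q^6}$ is called scattered if it meets every one-dimensional $\mathbb F_{q^6}$-subspace of $\mathbb F_{q^6}\times\mathbb F_{q^6}$ in an $\mathbb F_q$-subspace of dimension at most one, and maximum scattered if moreover $\dim_{\mathbb F_q}U=6$, i.e. half of the $\mathbb F_q$-dimension of $\mathbb F_{q^6}\times\mathbb F_{q^6}$. Let $\mathrm N_{q^6/q^3}(b)=b^{q^3+1}$ be the norm from $\mathbb F_{q^6}$ to $\mathbb F_{q^3}$, and put \[\Gamma=\{\mathrm N_{q^6/q^3}(b) : b\in\mathbb F_{q^6},\ U_b\text{ is maximum scattered}\}.\] Then \[|\Gamma|=\tfrac12\,(q^3-q^2-q-2).\] In particular $|\Gamma|=\lfloor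 (q^2+q+1)(q-2)/2\rfloor$. -/

import Mathlib

/-- An `F`-subspace `U` of the `K`-vector space `V` is scattered (with respect to the Desarguesian
spread): it meets every one-dimensional `K`-subspace of `V` in an `F`-subspace of dimension at
most one. -/
def IsScattered (F K : Type*) {V : Type*} [Field F] [Field K] [Algebra F K]
    [AddCommGroup V] [Module F V] [Module K V] [IsScalarTower F K V]
    (U : Submodule F V) : Prop :=
  ∀ v : V, v ≠ 0 →
    Module.rank F ↥(U ⊓ (Submodule.span K {v}).restrictScalars F) ≤ 1

/-- A maximum scattered `F`-subspace of `V`: it is scattered and its `F`-dimension is half of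
the `F`-dimension of `V` (that is, `r * n / 2` for `r = dim_K V` and `n = [K : F]`). -/
def IsMaximumScattered (F K : Type*) {V : Type*} [Field F] [Field K] [Algebra F K]
    [AddCommGroup V] [Module F V] [Module K V] [IsScalarTower F K V]
    (U : Submodule F V) : Prop :=
  IsScattered F K U ∧ 2 * Module.finrank F U = Module.finrank F V

/-- The `F`-subspace `U_b = {(x, b x ^ q + x ^ (q ^ 4)) : x ∈ K}` of `K × K`, where `q = |F|`. -/
def subspaceU (F : Type*) {K : Type*} [Field F] [Finite F] [Field K] [Algebra F K] (b : K) :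
    Submodule F (K × K) where
  carrier := {p | ∃ x : K, p = (x, b * x ^ Nat.card F + x ^ (Nat.card F ^ 4))}
  zero_mem' := ⟨0, by
    have h : Nat.card F ≠ 0 := Nat.card_pos.ne'
    rw [zero_pow h, zero_pow (pow_ne_zero 4 h), mul_zero, add_zero, Prod.mk_zero_zero]⟩
  add_mem' := by
    have := Fintype.ofFinite F
    have hadd : ∀ x y : K, (x + y) ^ Nat.card F = x ^ Nat.card F + y ^ Nat.card F := by
      intro x y
      have h := map_add (FiniteField.frobeniusAlgHom F K) x y
      simpa [Nat.card_eq_fintype_card] using h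
    have hpow : ∀ (k : ℕ) (x y : K),
        (x + y) ^ (Nat.card F ^ k) = x ^ (Nat.card F ^ k) + y ^ (Nat.card F ^ k) := by
      intro k
      induction k with
      | zero => intro x y; rw [pow_zero, pow_one, pow_one, pow_one]
      | succ k ih => intro x y; rw [pow_succ, pow_mul, pow_mul, pow_mul, ih, hadd]
    rintro _ _ ⟨x, rfl⟩ ⟨y, rfl⟩
    refine ⟨x + y, ?_⟩
    rw [hadd, hpow, Prod.mk_add_mk]
    congr 1
    ring
  smul_mem' := by
    have := Fintype.ofFinite F
    have hc : ∀ c : F, c ^ Nat.card F = c := by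
      intro c
      rw [Nat.card_eq_fintype_card, FiniteField.pow_card]
    have hc4 : ∀ c : F, c ^ (Nat.card F ^ 4) = c := by
      intro c
      rw [Nat.card_eq_fintype_card, FiniteField.pow_card_pow]
    rintro c _ ⟨x, rfl⟩
    refine ⟨c • x, ?_⟩
    rw [smul_pow, smul_pow, hc, hc4, Prod.smul_mk, mul_smul_comm, smul_add]

/-- The set `Γ = {N_{K/L}(b) : U_b is maximum scattered}` of norms. -/
def normSetGamma (F L K : Type*) [Field F] [Finite F] [Field L] [Field K]
    [Algebra F K] [Algebra L K] : Set L :=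
  {w | ∃ b : K, IsMaximumScattered F K (subspaceU F b) ∧ Algebra.norm L b = w}

/-! Write σ for the q-Frobenius of K, τ = σ³, and subscripts for conjugates: xᵢ = σⁱ(x). The set U_b
is a graph, so it fails to be scattered iff for some m the equation bσ(x) + σ⁴(x) = mx has two
F-independent solutions. For m = 0 this happens exactly when N(b) = 1. For m ≠ 0 put c = m⁻¹ and T =
c(bσ + σ⁴). As σ⁴ = σ on L, T is σ-semilinear on the two-dimensional L-space K, so by descent its
fixed space has F-dimension 2 iff T³ = 1. Since T³ is an L-linear combination of τ and the identity
with coefficients in K, this is a pair of equations in c (`TwistCubeEqOne`).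

Let g = 1/(1 - N(b)). For b ≠ 0 these equations force p = c₀c₂c₄ to satisfy p + σp = Tr(g) - 1 and
pσp = N(g). Conversely any such p comes from some c, by Hilbert 90 for K/L and surjectivity of the
norm L → F. In characteristic 2, no such p exists iff X² - (Tr(g) - 1)X + N(g) has two distinct
roots in F (`isScattered_subspaceU_iff_exists_root`).

It remains to count the g ≠ 0 with this property. The pairs (g, root) lie on a cubic threefold with
a rational node at (1, 1). Projection from the node reduces the count to a hyperbolic quadric and
gives q³ - q points. The q² elements of trace 1 carry one root each, the other g carry none or two,
and g = 0 is discarded. -/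

set_option linter.unusedSectionVars false

/-! ### Frobenius, norms and Hilbert 90 in the tower F ⊂ L ⊂ K. -/

section FiniteFieldTower

open Polynomial

theorem mem_range_algebraMap_of_pow_card_eq {A B : Type*} [Field A] [Finite A] [Field B]
    [Algebra A B] {x : B} (hx : x ^ Nat.card A = x) : ∃ a : A, algebraMap A B a = x := by
  have hq : 1 < Nat.card A := Finite.one_lt_card
  have hne : (X ^ Nat.card A - X : A[X]) ≠ 0 := FiniteField.X_pow_card_sub_X_ne_zero A hq
  have hs := Polynomial.splits_X_pow_nat_card_sub_X (K := A)
  have := hs.mem_range_of_isRoot hne (i := algebraMap A B) (x := x) (by simp [hx])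
  exact this

theorem exists_frobenius_algHom (F K : Type*) [Field F] [Finite F] [Field K] [Algebra F K] :
    ∃ σ : K →ₐ[F] K, ∀ x, σ x = x ^ Nat.card F := by
  have := Fintype.ofFinite F
  exact ⟨FiniteField.frobeniusAlgHom F K, fun x => by
    rw [FiniteField.coe_frobeniusAlgHom, Nat.card_eq_fintype_card]⟩

theorem finrank_eq_of_card_eq_pow {A B : Type*} [Field A] [Finite A] [Field B] [Finite B]
    [Algebra A B] {n : ℕ} (h : Nat.card B = Nat.card A ^ n) : Module.finrank A B = n := by
  have h1 : Nat.card B = Nat.card A ^ Module.finrank A B := Module.natCard_eq_pow_finrank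
  exact Nat.pow_right_injective (Finite.one_lt_card (α := A)) (h1.symm.trans h)

theorem exists_root_of_dvd_finrank {A B : Type*} [Field A] [Finite A] [Field B] [Finite B]
    [Algebra A B] (h2 : 2 ∣ Module.finrank A B) (t d : A) :
    ∃ p : B, p ^ 2 - algebraMap A B t * p + algebraMap A B d = 0 := by
  set f : A[X] := X ^ 2 - C t * X + C d with hf
  have hdeg : f.natDegree = 2 := by rw [hf]; compute_degree!
  have hf0 : f ≠ 0 := by rintro h; simp [h] at hdeg
  by_cases hi : Irreducible f
  · have hdvd : f ∣ X ^ (Nat.card A ^ Module.finrank A B) - X :=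
      hi.natDegree_dvd_iff_dvd_X_pow_card_pow_sub_X.1 (hdeg ▸ h2)
    rw [← Module.natCard_eq_pow_finrank] at hdvd
    have hs := Polynomial.splits_X_pow_nat_card_sub_X (K := B)
    have hdvd' : f.map (algebraMap A B) ∣ X ^ Nat.card B - X := by
      simpa using Polynomial.map_dvd (algebraMap A B) hdvd
    have hs' := hs.of_dvd (FiniteField.X_pow_card_sub_X_ne_zero B Finite.one_lt_card) hdvd'
    obtain ⟨p, hp⟩ := hs'.exists_eval_eq_zero (by
      rw [degree_map, degree_eq_natDegree hf0, hdeg]; decide)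
    exact ⟨p, by simpa [hf] using hp⟩
  · have : f.roots ≠ 0 := fun h => hi ((Polynomial.irreducible_iff_roots_eq_zero_of_degree_le_three
      (by omega) (by omega)).2 h)
    obtain ⟨a, ha⟩ := Multiset.exists_mem_of_ne_zero this
    have ha' := (Polynomial.mem_roots'.1 ha).2
    refine ⟨algebraMap A B a, ?_⟩
    have h0 : a ^ 2 - t * a + d = 0 := by simpa [hf] using ha'
    simpa using congrArg (algebraMap A B) h0

variable {F L K : Type*} [Field F] [Finite F] [Field L] [Finite L] [Field K] [Finite K]
  [Algebra F L] [Algebra L K] [Algebra F K] [IsScalarTower F L K]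
  {σ : K →ₐ[F] K}

theorem exists_algebraMap_eq_of_frobenius_fixed (hσ : ∀ x, σ x = x ^ Nat.card F) {x : K}
    (hx : σ x = x) : ∃ a : F, algebraMap F K a = x :=
  mem_range_algebraMap_of_pow_card_eq (by rw [← hσ, hx])

theorem frobenius_cube_apply (hσ : ∀ x, σ x = x ^ Nat.card F) (hL : Nat.card L = Nat.card F ^ 3)
    (x : K) : σ (σ (σ x)) = x ^ Nat.card L := by
  rw [hL]; simp only [hσ, ← pow_mul]; congr 1; ring

theorem frobenius_four_apply (hσ : ∀ x, σ x = x ^ Nat.card F) (x : K) :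
    σ (σ (σ (σ x))) = x ^ (Nat.card F ^ 4) := by
  simp only [hσ, ← pow_mul]; congr 1; ring

theorem exists_algebraMap_eq_of_frobenius_cube_fixed (hσ : ∀ x, σ x = x ^ Nat.card F)
    (hL : Nat.card L = Nat.card F ^ 3) {x : K} (hx : σ (σ (σ x)) = x) :
    ∃ l : L, algebraMap L K l = x :=
  mem_range_algebraMap_of_pow_card_eq (by rw [← frobenius_cube_apply hσ hL, hx])

theorem frobenius_cube_algebraMap (hσ : ∀ x, σ x = x ^ Nat.card F)
    (hL : Nat.card L = Nat.card F ^ 3) (l : L) :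
    σ (σ (σ (algebraMap L K l))) = algebraMap L K l := by
  have := Fintype.ofFinite L
  rw [frobenius_cube_apply hσ hL, ← map_pow, Nat.card_eq_fintype_card, FiniteField.pow_card]

theorem frobenius_six_apply (hσ : ∀ x, σ x = x ^ Nat.card F) (hK : Nat.card K = Nat.card F ^ 6)
    (x : K) : σ (σ (σ (σ (σ (σ x))))) = x := by
  have := Fintype.ofFinite K
  have h : σ (σ (σ (σ (σ (σ x))))) = x ^ Nat.card K := by
    rw [hK]; simp only [hσ, ← pow_mul]; congr 1; ring
  rw [h, Nat.card_eq_fintype_card, FiniteField.pow_card]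

theorem algebraMap_norm_eq_mul_frobenius (hσ : ∀ x, σ x = x ^ Nat.card F)
    (hL : Nat.card L = Nat.card F ^ 3) (hK : Nat.card K = Nat.card F ^ 6) (b : K) :
    algebraMap L K (Algebra.norm L b) = b * σ (σ (σ b)) := by
  have h2 : Module.finrank L K = 2 := finrank_eq_of_card_eq_pow (by rw [hK, hL]; ring)
  rw [FiniteField.algebraMap_norm_eq_prod_pow, h2, frobenius_cube_apply hσ hL]
  simp [Finset.prod_range_succ]

theorem algebraMap_norm_eq_prod_frobenius (hσ : ∀ x, σ x = x ^ Nat.card F)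
    (hL : Nat.card L = Nat.card F ^ 3) (l : L) :
    algebraMap F K (Algebra.norm F l) =
      algebraMap L K l * σ (algebraMap L K l) * σ (σ (algebraMap L K l)) := by
  have h3 : Module.finrank F L = 3 := finrank_eq_of_card_eq_pow hL
  rw [IsScalarTower.algebraMap_apply F L K, FiniteField.algebraMap_norm_eq_prod_pow, h3]
  simp [Finset.prod_range_succ, hσ, ← pow_mul, pow_succ]

theorem algebraMap_trace_eq_sum_frobenius (hσ : ∀ x, σ x = x ^ Nat.card F)
    (hL : Nat.card L = Nat.card F ^ 3) (l : L) :
    algebraMap F K (Algebra.trace F L l) =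
      algebraMap L K l + σ (algebraMap L K l) + σ (σ (algebraMap L K l)) := by
  have h3 : Module.finrank F L = 3 := finrank_eq_of_card_eq_pow hL
  rw [IsScalarTower.algebraMap_apply F L K, FiniteField.algebraMap_trace_eq_sum_pow, h3]
  simp [Finset.sum_range_succ, hσ, ← pow_mul, pow_succ]

theorem exists_frobenius_cube_ne (hσ : ∀ x, σ x = x ^ Nat.card F)
    (hL : Nat.card L = Nat.card F ^ 3) (hK : Nat.card K = Nat.card F ^ 6) :
    ∃ y : K, σ (σ (σ y)) ≠ y := by
  by_contra! h
  have hs : Function.Surjective (algebraMap L K) := fun y =>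
    exists_algebraMap_eq_of_frobenius_cube_fixed hσ hL (h y)
  have h1 := Nat.card_le_card_of_surjective _ hs
  rw [hL, hK] at h1
  have := Nat.pow_lt_pow_right (Finite.one_lt_card (α := F)) (show 3 < 6 by norm_num)
  omega

/-- Hilbert's theorem 90 for the quadratic extension `K / L`. -/
theorem exists_frobenius_cube_eq_mul (hσ : ∀ x, σ x = x ^ Nat.card F)
    (hL : Nat.card L = Nat.card F ^ 3) (hK : Nat.card K = Nat.card F ^ 6) {θ : K}
    (hθ : θ * σ (σ (σ θ)) = 1) : ∃ c : K, c ≠ 0 ∧ σ (σ (σ c)) = θ * c := by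
  -- Every Lagrange resolvent y + τ(θ)τ(y) is a solution. If all of them vanished, y = 1 would give
  -- τ(θ) = -1, and then τ would be the identity.
  have key : ∀ y, σ (σ (σ (y + σ (σ (σ θ)) * σ (σ (σ y))))) =
      θ * (y + σ (σ (σ θ)) * σ (σ (σ y))) := by
    intro y
    simp only [map_add, map_mul, frobenius_six_apply hσ hK]
    linear_combination -σ (σ (σ y)) * hθ
  by_contra! h
  have h0 : ∀ y, y + σ (σ (σ θ)) * σ (σ (σ y)) = 0 := fun y => by
    by_contra hy; exact h _ hy (key y)
  obtain ⟨y, hy⟩ := exists_frobenius_cube_ne (L := L) hσ hL hK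
  have h1 := h0 1
  simp only [map_one, mul_one] at h1
  exact hy (by linear_combination -h0 y + σ (σ (σ y)) * h1)

end FiniteFieldTower

/-! ### Algebra of the equation T³ = 1, with conjugates as independent variables. -/

section TwistedCube

/-- If the twisted cube of `c (b + τ) σ` is the identity, then `p = c₀ c₂ c₄` and its conjugate
`p' = c₁ c₃ c₅` have prescribed sum and product. -/
theorem add_eq_and_mul_eq_of_cube_eq_one {K : Type*} [Field K]
    {b0 b1 b2 b3 b4 b5 c0 c1 c2 c3 c4 c5 g0 g1 g2 : K}
    (hg0 : g0 * (1 - b0 * b3) = 1) (hg1 : g1 * (1 - b1 * b4) = 1) (hg2 : g2 * (1 - b2 * b5) = 1)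
    (hb1 : b1 ≠ 0) (hb4 : b4 ≠ 0) (hc2 : c2 ≠ 0) (hc5 : c5 ≠ 0)
    (hE : c2 * (b0 * b1 * c1 + c4) * b2 + c5 * (b0 * c1 + b4 * c4) = 0)
    (hG : c0 * (c2 * (b0 * b1 * c1 + c4) + c5 * (b0 * c1 + b4 * c4) * b5) = 1)
    (hE' : c5 * (b3 * b4 * c4 + c1) * b5 + c2 * (b3 * c4 + b1 * c1) = 0)
    (hG' : c3 * (c5 * (b3 * b4 * c4 + c1) + c2 * (b3 * c4 + b1 * c1) * b2) = 1) :
    c0 * c2 * c4 + c1 * c3 * c5 = g0 + g1 + g2 - 1 ∧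
      (c0 * c2 * c4) * (c1 * c3 * c5) = g0 * g1 * g2 := by
  -- With X = c2(b0b1c1 + c4) and Y = c5(b0c1 + b4c4), `hE` and `hG` are a linear system of
  -- determinant 1 - b2b5, so c0X = g2 and c0Y = -b2g2. These are `h1` and `h2`.
  have h1 : b0 * b1 * c0 * c1 * c2 = g2 - c0 * c2 * c4 := by
    linear_combination g2 * hG - g2 * c0 * b5 * hE
      - c0 * (c2 * (b0 * b1 * c1 + c4)) * hg2
  have h1' : b3 * b4 * c3 * c4 * c5 = g2 - c1 * c3 * c5 := by
    linear_combination g2 * hG' - g2 * c3 * b2 * hE'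
      - c3 * (c5 * (b3 * b4 * c4 + c1)) * hg2
  have h2 : c0 * c5 * (b0 * c1 + b4 * c4) = -b2 * g2 := by
    linear_combination c0 * hE - b2 * h1
  have h2' : c3 * c2 * (b3 * c4 + b1 * c1) = -b5 * g2 := by
    linear_combination c3 * hE' - b5 * h1'
  -- Eliminating c1 between `h1` and `h2` expresses c5/c2 through p alone. The converse uses this
  -- relation to construct c.
  have h3 : c5 * (g2 - (1 - b1 * b4) * (c0 * c2 * c4)) = -b1 * b2 * c2 * g2 := by
    linear_combination b1 * c2 * h2 - c5 * h1
  have h3' : c2 * (g2 - (1 - b1 * b4) * (c1 * c3 * c5)) = -b4 * b5 * c5 * g2 := by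
    linear_combination b4 * c5 * h2' - c2 * h1'
  generalize hp : c0 * c2 * c4 = p at *
  generalize hp' : c1 * c3 * c5 = p' at *
  have r1 : (g2 - p) * (g2 - p') = b0 * b3 * (b1 * b4) * (p * p') := by
    rw [← h1, ← h1', ← hp, ← hp']; ring
  have r2 : (g2 - (1 - b1 * b4) * p) * (g2 - (1 - b1 * b4) * p') =
      b1 * b4 * (b2 * b5) * g2 ^ 2 := by
    have : c2 * c5 ≠ 0 := mul_ne_zero hc2 hc5
    apply mul_left_cancel₀ this
    linear_combination c2 * (g2 - (1 - b1 * b4) * p') * h3 - b1 * b2 * c2 * g2 * h3'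
  have hn : b1 * b4 ≠ 0 := mul_ne_zero hb1 hb4
  generalize b0 * b3 = n0 at *
  generalize b1 * b4 = n1 at *
  generalize b2 * b5 = n2 at *
  -- `r1` and `r2` are linear in p + p' and pp'. Solving each for the sum and comparing gives the
  -- product, after cancelling n1.
  have t1 : p + p' = g2 + p * p' * (1 - n2) * (1 - n0 * n1) := by
    linear_combination -(1 - n2) * r1 + (g2 - p - p') * hg2
  have t2 : p + p' = (1 - n1) * (1 - n2) * (p * p') + g1 + g2 - 1 := by
    have e2 : (1 - n2) ≠ 0 := right_ne_zero_of_mul_eq_one hg2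
    have e1 : (1 - n1) ≠ 0 := right_ne_zero_of_mul_eq_one hg1
    obtain rfl : g2 = (1 - n2)⁻¹ := eq_inv_of_mul_eq_one_left hg2
    obtain rfl : g1 = (1 - n1)⁻¹ := eq_inv_of_mul_eq_one_left hg1
    field_simp at r2 ⊢
    linear_combination -r2
  have hd : p * p' = g0 * g1 * g2 := by
    apply mul_left_cancel₀ hn
    have h : n1 * (p * p') * (1 - n2) * (1 - n0) = n1 * g1 := by
      linear_combination t2 - t1 + hg1
    linear_combination g0 * g2 * h - n1 * (p * p') * (1 - n2) * g2 * hg0 - n1 * (p * p') * hg2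
  refine ⟨?_, hd⟩
  linear_combination t2 + (1 - n1) * (1 - n2) * hd + g0 * g2 * (1 - n2) * hg1 + g0 * hg2

/-- Converse of `add_eq_and_mul_eq_of_cube_eq_one`. -/
theorem cube_eq_one_of_add_eq_of_mul_eq {K : Type*} [Field K]
    {b0 b1 b2 b3 b4 b5 c0 c1 c2 c4 c5 g0 g1 g2 p p' : K}
    (hg0 : g0 * (1 - b0 * b3) = 1) (hg1 : g1 * (1 - b1 * b4) = 1) (hg2 : g2 * (1 - b2 * b5) = 1)
    (hb1 : b1 ≠ 0) (hc2 : c2 ≠ 0) (hc4 : c4 ≠ 0) (hne : g1 - (1 - b0 * b3) * p ≠ 0)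
    (hsum : p + p' = g0 + g1 + g2 - 1) (hprod : p * p' = g0 * g1 * g2)
    (hp : c0 * c2 * c4 = p)
    (h5 : c5 * (g2 - (1 - b1 * b4) * p) = -b1 * b2 * g2 * c2)
    (h1 : c1 * (g1 - (1 - b0 * b3) * p) = -b3 * b4 * g1 * c4) :
    c2 * (b0 * b1 * c1 + c4) * b2 + c5 * (b0 * c1 + b4 * c4) = 0 ∧
      c0 * (c2 * (b0 * b1 * c1 + c4) + c5 * (b0 * c1 + b4 * c4) * b5) = 1 := by
  have hz : b0 * b1 * c0 * c1 * c2 = g2 - p := by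
    apply mul_left_cancel₀ (mul_ne_zero hc4 hne)
    have hq : p ^ 2 = (g0 + g1 + g2 - 1) * p - g0 * g1 * g2 := by
      linear_combination p * hsum - hprod
    have h : b0 * b1 * p * (-b3 * b4 * g1) = (g1 - (1 - b0 * b3) * p) * (g2 - p) := by
      linear_combination -(1 - b0 * b3) * hq + g1 * g2 * hg0 + p * (b0 * b3) * hg1 - p * hg0
    linear_combination b0 * b1 * c0 * c2 * c4 * h1 + c4 * h + b0 * b1 * (-b3 * b4 * g1) * c4 * hp
  have hq : c0 * c5 * (b0 * c1 + b4 * c4) = -b2 * g2 := by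
    apply mul_left_cancel₀ (mul_ne_zero hb1 hc2)
    linear_combination c5 * hz + h5 + b1 * b4 * c5 * hp
  have hc0 : c0 ≠ 0 := by
    rintro rfl
    have : p * p' ≠ 0 := by
      rw [hprod]
      exact mul_ne_zero (mul_ne_zero (left_ne_zero_of_mul_eq_one hg0)
        (left_ne_zero_of_mul_eq_one hg1)) (left_ne_zero_of_mul_eq_one hg2)
    apply this; rw [← hp]; ring
  constructor
  · apply mul_left_cancel₀ hc0
    linear_combination b2 * hz + hq + b2 * hp
  · linear_combination hz + hp + b5 * hq + hg2

end TwistedCube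

/-! ### Scatteredness as a condition on T³. -/

section Scattered

variable {F L K : Type*} [Field F] [Finite F] [Field L] [Finite L] [Field K] [Finite K]
  [Algebra F L] [Algebra L K] [Algebra F K] [IsScalarTower F L K]
  {σ : K →ₐ[F] K}

theorem mem_subspaceU_iff (hσ : ∀ x, σ x = x ^ Nat.card F) {b : K} {v : K × K} :
    v ∈ subspaceU F b ↔ v.2 = b * σ v.1 + σ (σ (σ (σ v.1))) := by
  rw [frobenius_four_apply hσ, hσ]
  constructor
  · rintro ⟨x, rfl⟩; rfl
  · intro h; exact ⟨v.1, Prod.ext rfl h⟩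

theorem finrank_subspaceU (hσ : ∀ x, σ x = x ^ Nat.card F) (b : K) :
    Module.finrank F (subspaceU F b) = Module.finrank F K := by
  let e : subspaceU F b →ₗ[F] K := LinearMap.fst F K K ∘ₗ (subspaceU F b).subtype
  refine LinearEquiv.finrank_eq (LinearEquiv.ofBijective e ⟨?_, ?_⟩)
  · rintro ⟨u, hu⟩ ⟨v, hv⟩ (h : u.1 = v.1)
    rw [mem_subspaceU_iff hσ] at hu hv
    exact Subtype.ext (Prod.ext h (by rw [hu, hv, h]))
  · intro x
    exact ⟨⟨(x, b * σ x + σ (σ (σ (σ x)))), (mem_subspaceU_iff hσ).2 rfl⟩, rfl⟩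

theorem isMaximumScattered_subspaceU_iff (hσ : ∀ x, σ x = x ^ Nat.card F) (b : K) :
    IsMaximumScattered F K (subspaceU F b) ↔ IsScattered F K (subspaceU F b) := by
  have : Module.Finite F K := Module.Finite.of_finite
  rw [IsMaximumScattered, finrank_subspaceU hσ, Module.finrank_prod, ← two_mul]
  exact and_iff_left rfl

/-- A line of slope m meets the graph in the solutions of bσ(x) + σ⁴(x) = mx, and the vertical line
meets it only in 0. -/
theorem isScattered_subspaceU_iff (hσ : ∀ x, σ x = x ^ Nat.card F) (b : K) :
    IsScattered F K (subspaceU F b) ↔ ∀ m x y : K, x ≠ 0 →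
      b * σ x + σ (σ (σ (σ x))) = m * x → b * σ y + σ (σ (σ (σ y))) = m * y →
      ∃ a : F, y = a • x := by
  constructor
  · intro h m x y hx0 hx hy
    obtain ⟨v, -, hv⟩ := (rank_submodule_le_one_iff _).1 (h (1, m) (by simp))
    have key : ∀ z, b * σ z + σ (σ (σ (σ z))) = m * z → ∃ a : F, a • v.1 = z := by
      intro z hz
      have : (z, m * z) ∈ subspaceU F b ⊓ (Submodule.span K {((1, m) : K × K)}).restrictScalars F :=
        ⟨(mem_subspaceU_iff hσ).2 hz.symm,
          Submodule.mem_span_singleton.2 ⟨z, by simp [mul_comm]⟩⟩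
      obtain ⟨a, ha⟩ := Submodule.mem_span_singleton.1 (hv this)
      exact ⟨a, congrArg Prod.fst ha⟩
    obtain ⟨α, rfl⟩ := key x hx
    obtain ⟨β, rfl⟩ := key y hy
    have hα : α ≠ 0 := by rintro rfl; simp at hx0
    exact ⟨β * α⁻¹, by rw [smul_smul, mul_assoc, inv_mul_cancel₀ hα, mul_one]⟩
  · intro h v hv
    rw [rank_submodule_le_one_iff]
    by_cases hs : ∃ w ∈ subspaceU F b ⊓ (Submodule.span K {v}).restrictScalars F, w ≠ 0
    · obtain ⟨w, hw, hw0⟩ := hs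
      refine ⟨w, hw, fun w' hw' => Submodule.mem_span_singleton.2 ?_⟩
      have hU := (mem_subspaceU_iff hσ).1 hw.1
      have hU' := (mem_subspaceU_iff hσ).1 hw'.1
      obtain ⟨k, rfl⟩ := Submodule.mem_span_singleton.1 hw.2
      obtain ⟨k', rfl⟩ := Submodule.mem_span_singleton.1 hw'.2
      have hk : k ≠ 0 := by rintro rfl; simp at hw0
      have hv1 : v.1 ≠ 0 := by
        intro h0
        rw [Prod.smul_fst, Prod.smul_snd, h0] at hU
        simp [hk] at hU
        exact hv (Prod.ext h0 hU)
      obtain ⟨a, ha⟩ := h (v.2 / v.1) (k • v).1 (k' • v).1 (by simp [hk, hv1])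
        (by rw [← hU]; simp; field_simp) (by rw [← hU']; simp; field_simp)
      have h1 : k' = algebraMap F K a * k := by
        apply mul_right_cancel₀ hv1
        simpa [Algebra.smul_def, mul_assoc] using ha
      exact ⟨a, by rw [h1, mul_smul, algebraMap_smul]⟩
    · push Not at hs
      exact ⟨0, zero_mem _, fun w hw => by rw [hs w hw]; exact zero_mem _⟩

theorem twist_cube_apply (h6 : ∀ x, σ (σ (σ (σ (σ (σ x))))) = x) {b c : K} {T : K → K}
    (hT : ∀ x, T x = c * (b * σ x + σ (σ (σ (σ x))))) (x : K) :
    T (T (T x)) =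
      c * (σ (σ c) * (b * σ b * σ c + σ (σ (σ (σ c)))) * σ (σ b) +
        σ (σ (σ (σ (σ c)))) * (b * σ c + σ (σ (σ (σ b))) * σ (σ (σ (σ c))))) * σ (σ (σ x)) +
      c * (σ (σ c) * (b * σ b * σ c + σ (σ (σ (σ c)))) +
        σ (σ (σ (σ (σ c)))) * (b * σ c + σ (σ (σ (σ b))) * σ (σ (σ (σ c)))) *
          σ (σ (σ (σ (σ b))))) * x := by
  simp only [hT, map_mul, map_add, h6]
  ring

/-- The conditions on `c` for the twisted cube of `c (b σ + σ⁴)` to be the identity. -/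
def TwistCubeEqOne (σ : K →ₐ[F] K) (b c : K) : Prop :=
  σ (σ c) * (b * σ b * σ c + σ (σ (σ (σ c)))) * σ (σ b) +
    σ (σ (σ (σ (σ c)))) * (b * σ c + σ (σ (σ (σ b))) * σ (σ (σ (σ c)))) = 0 ∧
  c * (σ (σ c) * (b * σ b * σ c + σ (σ (σ (σ c)))) +
    σ (σ (σ (σ (σ c)))) * (b * σ c + σ (σ (σ (σ b))) * σ (σ (σ (σ c)))) *
      σ (σ (σ (σ (σ b))))) = 1

/-- Two independent fixed points of T are fixed by T³, which forces T³ = 1. -/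
theorem exists_twistCubeEqOne_of_not_isScattered (hσ : ∀ x, σ x = x ^ Nat.card F)
    (hK : Nat.card K = Nat.card F ^ 6) {b : K} (hb : b * σ (σ (σ b)) ≠ 1)
    (h : ¬ IsScattered F K (subspaceU F b)) : ∃ c, TwistCubeEqOne σ b c := by
  have h6 := frobenius_six_apply hσ hK
  rw [isScattered_subspaceU_iff hσ] at h
  push Not at h
  obtain ⟨m, x, y, hx0, hx, hy, hxy⟩ := h
  -- For m = 0, the σ⁵- and σ²-conjugates of the equation relate x and τ(x) in two ways, giving b₂b₅
  -- = 1.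
  have hm : m ≠ 0 := by
    rintro rfl
    have h1 : σ (σ (σ (σ (σ (b * σ x + σ (σ (σ (σ x)))))))) = 0 := by rw [hx]; simp
    have h2 : σ (σ (b * σ x + σ (σ (σ (σ x))))) = 0 := by rw [hx]; simp
    simp only [map_add, map_mul, h6] at h1 h2
    have h3 : σ (σ (b * σ (σ (σ b)))) = 1 := by
      apply mul_right_cancel₀ hx0
      simp only [map_mul]
      linear_combination σ (σ b) * h1 - h2
    have hi : Function.Injective σ := σ.toRingHom.injective
    exact hb (hi (hi (by rw [h3, map_one, map_one])))
  refine ⟨m⁻¹, ?_⟩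
  set c := m⁻¹ with hc
  set T : K → K := fun x => c * (b * σ x + σ (σ (σ (σ x)))) with hT
  have hTx : T x = x := by simp only [hT, hx, hc]; field_simp
  have hTy : T y = y := by simp only [hT, hy, hc]; field_simp
  have kx := twist_cube_apply h6 (fun _ => rfl : ∀ x, T x = c * (b * σ x + σ (σ (σ (σ x))))) x
  have ky := twist_cube_apply h6 (fun _ => rfl : ∀ x, T x = c * (b * σ x + σ (σ (σ (σ x))))) y
  rw [hTx, hTx, hTx] at kx
  rw [hTy, hTy, hTy] at ky
  rw [TwistCubeEqOne]
  set E := σ (σ c) * (b * σ b * σ c + σ (σ (σ (σ c)))) * σ (σ b) +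
        σ (σ (σ (σ (σ c)))) * (b * σ c + σ (σ (σ (σ b))) * σ (σ (σ (σ c))))
  set G := c * (σ (σ c) * (b * σ b * σ c + σ (σ (σ (σ c)))) +
    σ (σ (σ (σ (σ c)))) * (b * σ c + σ (σ (σ (σ b))) * σ (σ (σ (σ c)))) *
      σ (σ (σ (σ (σ b)))))
  have hc0 : c ≠ 0 := inv_ne_zero hm
  -- If E ≠ 0, then T³x = x determines τ(x)/x, so r = y/x is fixed by τ. Now T(rx) = σ(r)T(x) gives
  -- σ(r) = r, so r lies in F, against independence.
  have hE : E = 0 := by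
    by_contra hE
    have h1 : σ (σ (σ x)) * y = σ (σ (σ y)) * x := by
      apply mul_left_cancel₀ (mul_ne_zero hc0 hE)
      linear_combination x * ky - y * kx
    set r := y / x with hr
    have hyr : y = r * x := by rw [hr]; field_simp
    have h2 : σ (σ (σ r)) = r := by
      have h3 : σ (σ (σ x)) ≠ 0 := by simpa using hx0
      rw [hr, map_div₀, map_div₀, map_div₀, div_eq_div_iff h3 hx0]
      linear_combination -h1
    have h4 : σ r = r := by
      apply mul_right_cancel₀ hx0
      rw [← hyr]
      conv_rhs => rw [← hTy]
      conv_lhs => rw [← hTx]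
      simp only [hT, hyr, map_mul, h2]
      ring
    obtain ⟨a, ha⟩ := exists_algebraMap_eq_of_frobenius_fixed hσ h4
    exact hxy a (by rw [Algebra.smul_def, ha, hyr])
  refine ⟨hE, ?_⟩
  apply mul_right_cancel₀ hx0
  rw [hE] at kx
  linear_combination -kx

/-- Descent by averaging: when T³ = 1, the sum of the Tⁱ(lx) over i = 0, 1, 2 is fixed by T. This
embeds K in Hom_F(L, W), W being the fixed space, so 6 ≤ 3 dim W. -/
theorem not_isScattered_of_twistCubeEqOne (hσ : ∀ x, σ x = x ^ Nat.card F)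
    (hL : Nat.card L = Nat.card F ^ 3) (hK : Nat.card K = Nat.card F ^ 6) {b c : K}
    (h : TwistCubeEqOne σ b c) : ¬ IsScattered F K (subspaceU F b) := by
  have h6 := frobenius_six_apply hσ hK
  have hL3 := frobenius_cube_algebraMap (L := L) hσ hL
  have : Module.Finite F K := Module.Finite.of_finite
  have : Module.Finite F L := Module.Finite.of_finite
  intro hs
  rw [isScattered_subspaceU_iff hσ] at hs
  have hc0 : c ≠ 0 := by rintro rfl; simpa using h.2
  let S := σ.toLinearMap
  let T : K →ₗ[F] K := LinearMap.mulLeft F c ∘ₗ (LinearMap.mulLeft F b ∘ₗ S + S ∘ₗ S ∘ₗ S ∘ₗ S)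
  have hT : ∀ x, T x = c * (b * σ x + σ (σ (σ (σ x)))) := fun x => rfl
  have hT3 : ∀ x, T (T (T x)) = x := fun x => by
    rw [twist_cube_apply h6 hT, h.1, h.2]; ring
  have hTl : ∀ (l : L) x, T (algebraMap L K l * x) = σ (algebraMap L K l) * T x := fun l x => by
    simp only [hT, map_mul, hL3]; ring
  have hTl1 : ∀ (l : L) x, T (σ (algebraMap L K l) * x) = σ (σ (algebraMap L K l)) * T x :=
    fun l x => by simp only [hT, map_mul, hL3]; ring
  have hTl2 : ∀ (l : L) x, T (σ (σ (algebraMap L K l)) * x) = algebraMap L K l * T x :=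
    fun l x => by simp only [hT, map_mul, hL3]; ring
  let W : Submodule F K := LinearMap.eqLocus T LinearMap.id
  have hW : Module.finrank F W ≤ 1 := by
    by_cases hW : ∃ x ∈ W, x ≠ 0
    · obtain ⟨x, hx, hx0⟩ := hW
      refine finrank_le_one (⟨x, hx⟩ : W) fun y => ?_
      have hf : ∀ z ∈ W, b * σ z + σ (σ (σ (σ z))) = c⁻¹ * z := fun z hz => by
        have hz' : T z = z := hz
        rw [hT] at hz'
        rw [eq_inv_mul_iff_mul_eq₀ hc0, hz']
      obtain ⟨a, ha⟩ := hs c⁻¹ x y hx0 (hf x hx) (hf y y.2)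
      exact ⟨a, Subtype.ext ha.symm⟩
    · push Not at hW
      refine finrank_le_one 0 fun y => ⟨0, Subtype.ext ?_⟩
      simp [hW y y.2]
  let Φ : K →ₗ[F] L →ₗ[F] W := LinearMap.mk₂ F
    (fun x l => ⟨algebraMap L K l * x + σ (algebraMap L K l) * T x +
      σ (σ (algebraMap L K l)) * T (T x), by
        change T _ = _
        simp only [map_add, hTl, hTl1, hTl2, hT3, LinearMap.id_apply]
        ring⟩)
    (fun x y l => by ext; simp; ring)
    (fun a x l => by ext; simp only [map_smul]; simp [Algebra.smul_def, mul_add]; ring)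
    (fun x l l' => by ext; simp; ring)
    (fun a x l => by
      ext
      simp [Algebra.smul_def, mul_add, ← IsScalarTower.algebraMap_apply]; ring)
  have hΦ : Function.Injective Φ := by
    rw [injective_iff_map_eq_zero]
    intro x hx
    have h0 : ∀ l : L, algebraMap L K l * x + σ (algebraMap L K l) * T x +
      σ (σ (algebraMap L K l)) * T (T x) = 0 := fun l =>
        congrArg Subtype.val (LinearMap.congr_fun hx l)
    have := Fintype.ofFinite L
    have hq : 1 < Nat.card F := Finite.one_lt_card
    open Polynomial in
    -- Independence of 1, σ, σ² on L: a polynomial of degree at most q² cannot have q³ roots unless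
    -- it is zero.
    have hP : (C x * X + C (T x) * X ^ Nat.card F + C (T (T x)) * X ^ (Nat.card F ^ 2) : K[X]) = 0 := by
      apply Polynomial.eq_zero_of_natDegree_lt_card_of_eval_eq_zero _ (algebraMap L K).injective
      · intro l
        have := h0 l
        simp only [hσ, ← pow_mul] at this
        simp only [eval_add, eval_mul, eval_C, eval_X, eval_pow]
        linear_combination this
      · rw [← Nat.card_eq_fintype_card, hL]
        have h2 : Nat.card F ^ 2 < Nat.card F ^ 3 := Nat.pow_lt_pow_right hq (by norm_num)
        have h1 : Nat.card F ≤ Nat.card F ^ 2 := Nat.le_self_pow (by norm_num) _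
        refine lt_of_le_of_lt ?_ h2
        compute_degree
        omega
    have := congrArg (fun P => Polynomial.coeff P 1) hP
    simpa [Polynomial.coeff_X_pow, hq.ne, (Nat.one_lt_pow two_ne_zero hq).ne] using this
  have h1 := LinearMap.finrank_le_finrank_of_injective hΦ
  rw [Module.finrank_linearMap, finrank_eq_of_card_eq_pow hL, finrank_eq_of_card_eq_pow hK] at h1
  omega

/-- Hilbert 90 applied to -b gives a nonzero x with bσ(x) + σ⁴(x) = 0. All L-multiples of x are then
solutions too. -/
theorem not_isScattered_of_mul_eq_one (hσ : ∀ x, σ x = x ^ Nat.card F)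
    (hL : Nat.card L = Nat.card F ^ 3) (hK : Nat.card K = Nat.card F ^ 6) {b : K}
    (hb : b * σ (σ (σ b)) = 1) : ¬ IsScattered F K (subspaceU F b) := by
  have h6 := frobenius_six_apply hσ hK
  have hL3 := frobenius_cube_algebraMap (L := L) hσ hL
  rw [isScattered_subspaceU_iff hσ]
  intro hs
  obtain ⟨c, hc0, hc⟩ := exists_frobenius_cube_eq_mul (L := L) (θ := -b) hσ hL hK
    (by simp only [map_neg]; linear_combination hb)
  set x := σ (σ (σ (σ (σ c)))) with hx
  have hx0 : x ≠ 0 := by simpa [hx] using hc0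
  have hl : ∀ l : L, b * σ (algebraMap L K l * x) +
      σ (σ (σ (σ (algebraMap L K l * x)))) = 0 * (algebraMap L K l * x) := fun l => by
    simp only [map_mul, hL3, hx, h6, hc]
    ring
  have hs' : Function.Surjective (algebraMap F L) := fun l => by
    obtain ⟨a, ha⟩ := hs 0 x (algebraMap L K l * x) hx0 (by simpa using hl 1) (hl l)
    refine ⟨a, (algebraMap L K).injective ?_⟩
    rw [← IsScalarTower.algebraMap_apply]
    apply mul_right_cancel₀ hx0
    rw [ha, Algebra.smul_def]
  have h1 := Nat.card_le_card_of_surjective _ hs'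
  rw [hL] at h1
  have := Nat.pow_lt_pow_right (Finite.one_lt_card (α := F)) (show 1 < 3 by norm_num)
  rw [pow_one] at this
  omega

end Scattered

/-! ### From T³ = 1 to a quadratic over F. -/

section Classification

/-- The norm-one condition that makes Hilbert 90 applicable to the prescribed ratio c₅/c₂. -/
theorem mul_eq_of_add_eq_of_mul_eq {K : Type*} [Field K] {n1 n2 g0 g1 g2 p p' : K}
    (hg1 : g1 * (1 - n1) = 1) (hg2 : g2 * (1 - n2) = 1)
    (hsum : p + p' = g0 + g1 + g2 - 1) (hprod : p * p' = g0 * g1 * g2) :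
    (g2 - (1 - n1) * p) * (g2 - (1 - n1) * p') = n1 * n2 * g2 ^ 2 := by
  linear_combination -(1 - n1) * g2 * hsum + (1 - n1) ^ 2 * hprod
    + ((1 - n1) * g0 * g2 - g2) * hg1 + n1 * g2 * hg2

/-- Compatibility of the three conjugate ratio conditions: it makes p/(c₀c₂c₄) invariant under σ for
the c built from Hilbert 90. -/
theorem prod_sub_eq_of_add_eq_of_mul_eq {K : Type*} [Field K] {n0 n1 n2 g0 g1 g2 p p' : K}
    (hg0 : g0 * (1 - n0) = 1) (hg1 : g1 * (1 - n1) = 1) (hg2 : g2 * (1 - n2) = 1)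
    (hsum : p + p' = g0 + g1 + g2 - 1) (hprod : p * p' = g0 * g1 * g2) :
    (g2 - (1 - n1) * p) * (g1 - (1 - n0) * p) * (g0 - (1 - n2) * p) =
      -(n0 * n1 * n2) * p ^ 2 := by
  have e2 : (1 - n2) ≠ 0 := right_ne_zero_of_mul_eq_one hg2
  have e1 : (1 - n1) ≠ 0 := right_ne_zero_of_mul_eq_one hg1
  have e0 : (1 - n0) ≠ 0 := right_ne_zero_of_mul_eq_one hg0
  have hq : p ^ 2 = (g0 + g1 + g2 - 1) * p - g0 * g1 * g2 := by
    linear_combination p * hsum - hprod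
  obtain rfl : g2 = (1 - n2)⁻¹ := eq_inv_of_mul_eq_one_left hg2
  obtain rfl : g1 = (1 - n1)⁻¹ := eq_inv_of_mul_eq_one_left hg1
  obtain rfl : g0 = (1 - n0)⁻¹ := eq_inv_of_mul_eq_one_left hg0
  field_simp at hq ⊢
  linear_combination (1 - (1 - n0) * (1 - n1) * (1 - n2) * p) * hq

variable {F L K : Type*} [Field F] [Finite F] [Field L] [Finite L] [Field K] [Finite K]
  [Algebra F L] [Algebra L K] [Algebra F K] [IsScalarTower F L K]
  {σ : K →ₐ[F] K}

theorem exists_twistCubeEqOne_of_add_eq_of_mul_eq (hσ : ∀ x, σ x = x ^ Nat.card F)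
    (hL : Nat.card L = Nat.card F ^ 3) (hK : Nat.card K = Nat.card F ^ 6) {b p γ : K}
    (hb : b ≠ 0) (hγ : γ * (1 - b * σ (σ (σ b))) = 1)
    (hsum : p + σ p = γ + σ γ + σ (σ γ) - 1) (hprod : p * σ p = γ * σ γ * σ (σ γ)) :
    ∃ c, TwistCubeEqOne σ b c := by
  have h6 := frobenius_six_apply hσ hK
  have hL3 := frobenius_cube_algebraMap (L := L) hσ hL
  have hσ0 : ∀ {x : K}, x ≠ 0 → σ x ≠ 0 := fun h => by simpa using h
  have hγ0 : γ ≠ 0 := left_ne_zero_of_mul_eq_one hγ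
  have hγ3 : σ (σ (σ γ)) = γ := by
    have h := congrArg (fun x => σ (σ (σ x))) hγ
    simp only [map_mul, map_sub, map_one, h6] at h
    apply mul_right_cancel₀ (right_ne_zero_of_mul_eq_one hγ)
    linear_combination h - hγ
  have hγ1 := congrArg σ hγ
  have hγ2 := congrArg σ hγ1
  simp only [map_mul, map_sub, map_one] at hγ1 hγ2
  have hp2 : σ (σ p) = p := by
    have h := congrArg σ hsum
    simp only [map_sub, map_add, map_one, hγ3] at h
    linear_combination h - hsum
  have hp0 : p ≠ 0 := by
    rintro rfl
    rw [zero_mul] at hprod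
    exact mul_ne_zero (mul_ne_zero hγ0 (hσ0 hγ0)) (hσ0 (hσ0 hγ0)) hprod.symm
  have hsum' : p + σ p = σ (σ γ) + γ + σ γ - 1 := by rw [hsum]; ring
  have hprod' : p * σ p = σ (σ γ) * γ * σ γ := by rw [hprod]; ring
  have r5 := mul_eq_of_add_eq_of_mul_eq hγ1 hγ2 hsum hprod
  have r1 := mul_eq_of_add_eq_of_mul_eq hγ hγ1 hsum' hprod'
  have hn5 : σ (σ γ) - (1 - σ b * σ (σ (σ (σ b)))) * p ≠ 0 := fun h => by
    rw [h, zero_mul] at r5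
    simp [hb, hγ0] at r5
  have hn1 : σ γ - (1 - b * σ (σ (σ b))) * p ≠ 0 := fun h => by
    rw [h, zero_mul] at r1
    simp [hb, hγ0] at r1
  -- θ is the value that c₅/c₂ must take, so d plays the role of c₂ and c' = σ⁴(d).
  obtain ⟨d, hd0, hd⟩ := exists_frobenius_cube_eq_mul (L := L) hσ hL hK
    (θ := -σ b * σ (σ b) * σ (σ γ) / (σ (σ γ) - (1 - σ b * σ (σ (σ (σ b)))) * p)) (by
      have hn5' := hσ0 (hσ0 (hσ0 hn5))
      simp only [map_div₀, map_mul, map_sub, map_neg, map_one, h6, hγ3, hp2] at hn5' ⊢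
      rw [div_mul_div_comm, div_eq_one_iff_eq (mul_ne_zero hn5 hn5')]
      linear_combination -r5)
  rw [div_mul_eq_mul_div, eq_div_iff hn5] at hd
  set c' := σ (σ (σ (σ d))) with hc'
  have hc2 : σ (σ c') = d := by rw [hc', h6]
  have hc0' : c' ≠ 0 := hσ0 (hσ0 (hσ0 (hσ0 hd0)))
  rw [← hc2] at hd
  have hd1 := congrArg (fun x => σ (σ x)) hd
  have hd3 := congrArg (fun x => σ (σ (σ (σ x)))) hd
  simp only [map_mul, map_sub, map_neg, map_one, h6, hγ3, hp2] at hd1 hd3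
  set p₀ := c' * σ (σ c') * σ (σ (σ (σ c'))) with hp₀
  have hp₀0 : p₀ ≠ 0 := mul_ne_zero (mul_ne_zero hc0' (hσ0 (hσ0 hc0')))
    (hσ0 (hσ0 (hσ0 (hσ0 hc0'))))
  have hratio : σ (p / p₀) = p / p₀ := by
    rw [map_div₀, div_eq_div_iff (hσ0 hp₀0) hp₀0]
    have hpi := prod_sub_eq_of_add_eq_of_mul_eq hγ hγ1 hγ2 hsum hprod
    have hm := congrArg₂ (· * ·) (congrArg₂ (· * ·) hd hd1) hd3
    beta_reduce at hm
    set ν := b * σ (σ (σ b)) * (σ b * σ (σ (σ (σ b)))) *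
        (σ (σ b) * σ (σ (σ (σ (σ b))))) with hν
    have hν0 : ν ≠ 0 := by simp [hν, hb]
    apply mul_left_cancel₀ (mul_ne_zero hν0 hp0)
    simp only [hp₀, map_mul]
    linear_combination ν * (c' * σ (σ c') * σ (σ (σ (σ c')))) * hprod + hm
      - σ c' * σ (σ (σ c')) * σ (σ (σ (σ (σ c')))) * hpi
  obtain ⟨r, hr⟩ := exists_algebraMap_eq_of_frobenius_fixed hσ hratio
  -- Scaling c' by an element of L keeps the ratio c₅/c₂ and multiplies c₀c₂c₄ by its norm to F, so
  -- the product can be adjusted to p.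
  obtain ⟨l, hl⟩ := FiniteField.norm_surjective F L r
  have hl' := algebraMap_norm_eq_prod_frobenius (K := K) hσ hL l
  have hl3 := hL3 l
  rw [hl, hr] at hl'
  set u := algebraMap L K l
  have hu0 : u ≠ 0 := by
    rintro h
    rw [h] at hl'
    simp [hp0, hp₀0] at hl'
  have hc0 : u * c' ≠ 0 := mul_ne_zero hu0 hc0'
  refine ⟨u * c', cube_eq_one_of_add_eq_of_mul_eq hγ hγ1 hγ2 (hσ0 hb) (hσ0 (hσ0 hc0))
    (hσ0 (hσ0 (hσ0 (hσ0 hc0)))) hn1 hsum hprod ?_ ?_ ?_⟩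
  · rw [div_eq_iff hp₀0] at hl'
    simp only [map_mul, hl3]
    rw [hl', hp₀]
    ring
  · simp only [map_mul, hl3]
    linear_combination σ (σ u) * hd
  · simp only [map_mul, hl3]
    linear_combination σ u * hd1

theorem twistCubeEqOne_zero_one : TwistCubeEqOne σ 0 1 := by
  simp [TwistCubeEqOne]

theorem add_eq_and_mul_eq_of_twistCubeEqOne (hσ : ∀ x, σ x = x ^ Nat.card F)
    (hK : Nat.card K = Nat.card F ^ 6) {b c γ : K}
    (hb : b ≠ 0) (hγ : γ * (1 - b * σ (σ (σ b))) = 1) (h : TwistCubeEqOne σ b c) :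
    ∃ p, p + σ p = γ + σ γ + σ (σ γ) - 1 ∧ p * σ p = γ * σ γ * σ (σ γ) := by
  have h6 := frobenius_six_apply hσ hK
  have hσ0 : ∀ {x : K}, x ≠ 0 → σ x ≠ 0 := fun h => by simpa using h
  have hc : c ≠ 0 := by rintro rfl; simpa using h.2
  have hγ1 := congrArg σ hγ
  have hγ2 := congrArg σ hγ1
  simp only [map_mul, map_sub, map_one] at hγ1 hγ2
  have hE := congrArg (fun x => σ (σ (σ x))) h.1
  have hG := congrArg (fun x => σ (σ (σ x))) h.2
  simp only [map_mul, map_add, map_one, map_zero, h6] at hE hG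
  refine ⟨c * σ (σ c) * σ (σ (σ (σ c))), ?_⟩
  simp only [map_mul]
  exact add_eq_and_mul_eq_of_cube_eq_one hγ hγ1 hγ2 (hσ0 hb) (hσ0 (hσ0 (hσ0 (hσ0 hb))))
    (hσ0 (hσ0 hc)) (hσ0 (hσ0 (hσ0 (hσ0 (hσ0 hc))))) h.1 h.2 hE hG

/-- An obstruction p is fixed by σ². Either p lies outside F, conjugate to the other root of an
irreducible quadratic, or p lies in F and Tr(g) - 1 = 2p = 0. Scatteredness excludes both. -/
theorem isScattered_subspaceU_iff_exists_root [CharP F 2]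
    (hL : Nat.card L = Nat.card F ^ 3) (hK : Nat.card K = Nat.card F ^ 6) (b : K) :
    IsScattered F K (subspaceU F b) ↔ ∃ g : L, g * (1 - Algebra.norm L b) = 1 ∧
      Algebra.trace F L g ≠ 1 ∧
      ∃ a : F, a ^ 2 - (Algebra.trace F L g - 1) * a + Algebra.norm F g = 0 := by
  obtain ⟨σ, hσ⟩ := exists_frobenius_algHom F K
  have hn := algebraMap_norm_eq_mul_frobenius hσ hL hK b
  have hi : Function.Injective σ := σ.toRingHom.injective
  constructor
  · intro hs
    have hb1 : 1 - Algebra.norm L b ≠ 0 := fun h => by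
      refine not_isScattered_of_mul_eq_one (L := L) hσ hL hK ?_ hs
      rw [← hn, ← sub_eq_zero.1 h, map_one]
    refine ⟨_, inv_mul_cancel₀ hb1, ?_⟩
    have hg := inv_mul_cancel₀ hb1
    generalize (1 - Algebra.norm L b)⁻¹ = g at hg
    have htr := algebraMap_trace_eq_sum_frobenius (K := K) hσ hL g
    have hno := algebraMap_norm_eq_prod_frobenius (K := K) hσ hL g
    by_contra hcon
    obtain ⟨p, hsum, hprod⟩ : ∃ p : K, p + σ p = algebraMap F K (Algebra.trace F L g - 1) ∧
        p * σ p = algebraMap F K (Algebra.norm F g) := by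
      by_cases h1 : Algebra.trace F L g = 1
      -- When Tr(g) = 1, the square root of N(g) in F serves as p, since its double vanishes.
      · obtain ⟨a, ha⟩ := FiniteField.isSquare_of_char_two (ringChar.eq F 2)
          (Algebra.norm F g)
        refine ⟨algebraMap F K a, ?_, ?_⟩
        · rw [h1, AlgHom.commutes, ← map_add, CharTwo.add_self_eq_zero, sub_self]
        · rw [ha, AlgHom.commutes, map_mul]
      · obtain ⟨p, hp⟩ := exists_root_of_dvd_finrank (B := K)
          (by rw [finrank_eq_of_card_eq_pow hK]; norm_num) (Algebra.trace F L g - 1)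
          (Algebra.norm F g)
        have hp' := congrArg σ hp
        simp only [map_add, map_sub, map_mul, map_pow, AlgHom.commutes, map_zero, map_one]
          at hp' hp ⊢
        have hne : p - σ p ≠ 0 := fun h => by
          obtain ⟨a, rfl⟩ := exists_algebraMap_eq_of_frobenius_fixed hσ (sub_eq_zero.1 h).symm
          refine hcon ⟨h1, a, (algebraMap F K).injective ?_⟩
          simpa using hp
        have hsum : p + σ p = algebraMap F K (Algebra.trace F L g) - 1 := by
          apply mul_left_cancel₀ hne
          linear_combination hp - hp'
        exact ⟨p, hsum, by linear_combination p * hsum - hp⟩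
    rw [map_sub, map_one, htr] at hsum
    rw [hno] at hprod
    have hg' := congrArg (algebraMap L K) hg
    rw [map_mul, map_sub, map_one, hn] at hg'
    obtain ⟨c, hc⟩ : ∃ c, TwistCubeEqOne σ b c := by
      by_cases hb : b = 0
      · subst hb; exact ⟨1, twistCubeEqOne_zero_one⟩
      · exact exists_twistCubeEqOne_of_add_eq_of_mul_eq (L := L) hσ hL hK hb hg' hsum hprod
    exact not_isScattered_of_twistCubeEqOne (L := L) hσ hL hK hc hs
  · rintro ⟨g, hg, htr1, a, ha⟩
    have htr := algebraMap_trace_eq_sum_frobenius (K := K) hσ hL g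
    have hno := algebraMap_norm_eq_prod_frobenius (K := K) hσ hL g
    have hg' := congrArg (algebraMap L K) hg
    rw [map_mul, map_sub, map_one, hn] at hg'
    by_contra hs
    obtain ⟨c, hc⟩ := exists_twistCubeEqOne_of_not_isScattered hσ hK
      (fun h => by simp [h] at hg') hs
    have hb : b ≠ 0 := by
      rintro rfl
      have : Module.Finite L K := Module.Finite.of_finite
      simp only [Algebra.norm_zero, sub_zero, mul_one] at hg
      apply htr1
      rw [hg, ← map_one (algebraMap F L), Algebra.trace_algebraMap, finrank_eq_of_card_eq_pow hL]
      have := CharTwo.two_eq_zero (R := F)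
      linear_combination this
    obtain ⟨p, hsum, hprod⟩ := add_eq_and_mul_eq_of_twistCubeEqOne hσ hK hb hg' hc
    rw [← htr] at hsum
    rw [← hno] at hprod
    have ha' := congrArg (algebraMap F K) ha
    simp only [map_add, map_sub, map_mul, map_pow, map_zero, map_one] at ha'
    -- The product is the quadratic evaluated at a, so p = a lies in F and its trace condition
    -- degenerates.
    have hroot : (p - algebraMap F K a) * σ (p - algebraMap F K a) = 0 := by
      rw [map_sub, AlgHom.commutes]
      linear_combination ha' + hprod - algebraMap F K a * hsum
    have hpa : p - algebraMap F K a = 0 :=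
      (mul_eq_zero.1 hroot).elim id (map_eq_zero σ).1
    rw [sub_eq_zero.1 hpa, AlgHom.commutes, ← map_add, CharTwo.add_self_eq_zero, map_zero] at hsum
    apply htr1
    apply (algebraMap F K).injective
    rw [map_one]
    linear_combination -hsum

end Classification

/-! ### Coordinates on L adapted to the trace and the second symmetric function. -/

section Counting

variable {F L : Type*} [Field F] [Finite F] [Field L] [Finite L] [Algebra F L]

theorem frobenius_three_apply {φ : L →ₐ[F] L} (hφ : ∀ x, φ x = x ^ Nat.card F)
    (hL : Nat.card L = Nat.card F ^ 3) (x : L) : φ (φ (φ x)) = x := by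
  have := Fintype.ofFinite L
  rw [frobenius_cube_apply hφ hL, Nat.card_eq_fintype_card, FiniteField.pow_card]

/-- The second elementary symmetric function of the conjugates in a cubic extension. -/
noncomputable def conjSymmTwo (φ : L →ₐ[F] L) (h : L) : F := Algebra.trace F L (h * φ h)

theorem algebraMap_trace_cubic {φ : L →ₐ[F] L} (hφ : ∀ x, φ x = x ^ Nat.card F)
    (hL : Nat.card L = Nat.card F ^ 3) (h : L) :
    algebraMap F L (Algebra.trace F L h) = h + φ h + φ (φ h) := by
  simpa using algebraMap_trace_eq_sum_frobenius (L := L) hφ hL h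

theorem algebraMap_norm_cubic {φ : L →ₐ[F] L} (hφ : ∀ x, φ x = x ^ Nat.card F)
    (hL : Nat.card L = Nat.card F ^ 3) (h : L) :
    algebraMap F L (Algebra.norm F h) = h * φ h * φ (φ h) := by
  simpa using algebraMap_norm_eq_prod_frobenius (L := L) hφ hL h

theorem algebraMap_conjSymmTwo {φ : L →ₐ[F] L} (hφ : ∀ x, φ x = x ^ Nat.card F)
    (hL : Nat.card L = Nat.card F ^ 3) (h : L) :
    algebraMap F L (conjSymmTwo φ h) = h * φ h + φ h * φ (φ h) + φ (φ h) * h := by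
  rw [conjSymmTwo, algebraMap_trace_cubic hφ hL]
  simp only [map_mul, frobenius_three_apply hφ hL]

theorem norm_one_add_cubic {φ : L →ₐ[F] L} (hφ : ∀ x, φ x = x ^ Nat.card F)
    (hL : Nat.card L = Nat.card F ^ 3) (h : L) :
    Algebra.norm F (1 + h) =
      1 + Algebra.trace F L h + conjSymmTwo φ h + Algebra.norm F h := by
  apply (algebraMap F L).injective
  simp only [map_add, map_one, algebraMap_trace_cubic hφ hL, algebraMap_norm_cubic hφ hL,
    algebraMap_conjSymmTwo hφ hL]
  ring

theorem trace_one_cubic (hL : Nat.card L = Nat.card F ^ 3) :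
    Algebra.trace F L 1 = 3 := by
  rw [← map_one (algebraMap F L), Algebra.trace_algebraMap, finrank_eq_of_card_eq_pow hL]
  simp

theorem conjSymmTwo_smul (φ : L →ₐ[F] L) (r : F) (h : L) :
    conjSymmTwo φ (r • h) = r ^ 2 * conjSymmTwo φ h := by
  rw [conjSymmTwo, map_smul, smul_mul_smul_comm, map_smul, smul_eq_mul, conjSymmTwo, pow_two]

theorem exists_trace_eq_zero_conjSymmTwo_eq_one [CharP F 2] {φ : L →ₐ[F] L}
    (hφ : ∀ x, φ x = x ^ Nat.card F) (hL : Nat.card L = Nat.card F ^ 3) :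
    ∃ u : L, Algebra.trace F L u = 0 ∧ conjSymmTwo φ u = 1 := by
  have h2 := CharTwo.two_eq_zero (R := F)
  have : Module.Finite F L := Module.Finite.of_finite
  suffices ∃ u : L, Algebra.trace F L u = 0 ∧ conjSymmTwo φ u ≠ 0 by
    obtain ⟨u, hu, hu'⟩ := this
    obtain ⟨r, hr⟩ := FiniteField.isSquare_of_char_two (ringChar.eq F 2) (conjSymmTwo φ u)⁻¹
    refine ⟨r • u, by rw [map_smul, hu, smul_zero], ?_⟩
    rw [conjSymmTwo_smul, pow_two, ← hr, inv_mul_cancel₀ hu']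
  by_contra! hcon
  -- Polarizing: if the second symmetric function vanished on trace-zero elements, that hyperplane
  -- would be totally isotropic for the trace form. It is also orthogonal to F, hence to all of L,
  -- contradicting nondegeneracy.
  have hmul : ∀ u v : L, Algebra.trace F L u = 0 → Algebra.trace F L v = 0 →
      Algebra.trace F L (u * v) = 0 := by
    intro u v hu hv
    have huv := hcon (u + v) (by rw [map_add, hu, hv, add_zero])
    have hpol : conjSymmTwo φ (u + v) = conjSymmTwo φ u + conjSymmTwo φ v +
        Algebra.trace F L u * Algebra.trace F L v - Algebra.trace F L (u * v) := by
      apply (algebraMap F L).injective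
      simp only [map_add, map_sub, map_mul, algebraMap_trace_cubic hφ hL,
        algebraMap_conjSymmTwo hφ hL]
      ring
    rw [huv, hcon u hu, hcon v hv, hu] at hpol
    linear_combination hpol
  have hzero : ∀ u : L, Algebra.trace F L u = 0 → u = 0 := by
    intro u hu
    refine (traceForm_nondegenerate F L).1 u fun x => ?_
    rw [Algebra.traceForm_apply]
    have hx := hmul u (x - algebraMap F L (Algebra.trace F L x)) hu (by
      rw [map_sub, Algebra.trace_algebraMap, finrank_eq_of_card_eq_pow hL]
      simp only [nsmul_eq_mul, Nat.cast_ofNat]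
      linear_combination -Algebra.trace F L x * h2)
    rw [mul_sub, map_sub, mul_comm u (algebraMap F L _), ← Algebra.smul_def, map_smul, hu] at hx
    simpa using hx
  have hinj : Function.Injective (Algebra.trace F L) :=
    (injective_iff_map_eq_zero _).2 hzero
  have h1 := Nat.card_le_card_of_injective _ hinj
  rw [hL] at h1
  have := Nat.pow_lt_pow_right (Finite.one_lt_card (α := F)) (show 1 < 3 by norm_num)
  rw [pow_one] at this
  omega

/-- As 3 = 1 in F, L is the sum of F and the trace-zero plane. A trace-zero u with `conjSymmTwo φ u
= 1` gives the basis u, φ(u) of that plane. -/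
theorem exists_cubic_coordinates [CharP F 2] {φ : L →ₐ[F] L}
    (hφ : ∀ x, φ x = x ^ Nat.card F) (hL : Nat.card L = Nat.card F ^ 3) :
    ∃ e : F × F × F ≃ L, ∀ c s t : F, Algebra.trace F L (e (c, s, t)) = c ∧
      conjSymmTwo φ (e (c, s, t)) = c ^ 2 + (s ^ 2 + s * t + t ^ 2) := by
  obtain ⟨u, hu, hu'⟩ := exists_trace_eq_zero_conjSymmTwo_eq_one hφ hL
  have h2 := CharTwo.two_eq_zero (R := F)
  have h3 := frobenius_three_apply hφ hL
  have hu1 := algebraMap_trace_cubic hφ hL u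
  have hu2 := algebraMap_conjSymmTwo hφ hL u
  rw [hu, map_zero] at hu1
  rw [hu', map_one] at hu2
  let f : F × F × F → L := fun x =>
    algebraMap F L x.1 + algebraMap F L x.2.1 * u + algebraMap F L x.2.2 * φ u
  have htr : ∀ c s t, Algebra.trace F L (f (c, s, t)) = c := fun c s t => by
    apply (algebraMap F L).injective
    have h2' := congrArg (algebraMap F L) h2
    rw [map_zero, map_ofNat] at h2'
    simp only [algebraMap_trace_cubic hφ hL, f, map_add, map_mul, AlgHom.commutes, h3]
    linear_combination -(algebraMap F L s + algebraMap F L t) * hu1 + algebraMap F L c * h2'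
  have hS : ∀ c s t, conjSymmTwo φ (f (c, s, t)) = c ^ 2 + (s ^ 2 + s * t + t ^ 2) :=
    fun c s t => by
      have : conjSymmTwo φ (f (c, s, t)) = 3 * c ^ 2 + (s ^ 2 - s * t + t ^ 2) := by
        apply (algebraMap F L).injective
        simp only [algebraMap_conjSymmTwo hφ hL, f, map_add, map_sub, map_mul, map_pow,
          AlgHom.commutes, h3, map_ofNat]
        generalize algebraMap F L c = c'
        generalize algebraMap F L s = s'
        generalize algebraMap F L t = t'
        have hphi : φ (φ u) = -u - φ u := by linear_combination -hu1
        rw [hphi] at hu2 ⊢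
        linear_combination -(s' ^ 2 - s' * t' + t' ^ 2) * hu2
      rw [this]
      linear_combination (c ^ 2 - s * t) * h2
  have hf0 : ∀ c s t, f (c, s, t) = 0 → c = 0 ∧ s = 0 ∧ t = 0 := fun c s t h => by
    have hc : c = 0 := by rw [← htr c s t, h, map_zero]
    subst hc
    simp only [f, map_zero, zero_add] at h
    have h' := congrArg φ h
    simp only [map_add, map_mul, AlgHom.commutes, map_zero] at h'
    have hphi : φ (φ u) = -u - φ u := by linear_combination -hu1
    rw [hphi] at hu2 h'
    have hs : algebraMap F L s = 0 := by
      linear_combination algebraMap F L s * hu2 - (u + φ u) * h - φ u * h'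
    have ht : algebraMap F L t = 0 := by
      linear_combination algebraMap F L t * hu2 - φ u * h + u * h'
    exact ⟨rfl, by simpa using hs, by simpa using ht⟩
  have hinj : Function.Injective f := by
    rintro ⟨c, s, t⟩ ⟨c', s', t'⟩ h
    have := hf0 (c - c') (s - s') (t - t') (by
      simp only [f, map_sub] at h ⊢
      linear_combination h)
    simpa [sub_eq_zero] using this
  have hbij : Function.Bijective f := by
    have := Fintype.ofFinite F
    have := Fintype.ofFinite L
    refine (Fintype.bijective_iff_injective_and_card f).2 ⟨hinj, ?_⟩
    rw [← Nat.card_eq_fintype_card, ← Nat.card_eq_fintype_card (α := L), hL]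
    simp only [Nat.card_prod]
    ring
  exact ⟨Equiv.ofBijective f hbij, fun c s t => ⟨htr c s t, hS c s t⟩⟩

end Counting

/-! ### Point counts on the quadric and on the cubic threefold. -/

section Counting

theorem natCard_subtype_prod {A B : Type*} [Fintype A] [Finite B] (P : A → B → Prop) :
    Nat.card {x : A × B // P x.1 x.2} = ∑ a, Nat.card {b // P a b} := by
  rw [Nat.card_congr (Equiv.subtypeProdEquivSigmaSubtype P), Nat.card_sigma]

variable {F : Type*} [Field F] [Finite F]

theorem natCard_affine_line {α p r : F} (h : ¬ (p = 0 ∧ r = 0)) :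
    Nat.card {x : F × F // α + p * x.2 + r * x.1 = 0} = Nat.card F := by
  by_cases hp : p = 0
  · have hr : r ≠ 0 := fun hr => h ⟨hp, hr⟩
    refine Nat.card_congr ⟨fun x => x.1.2, fun t => ⟨(-α / r, t), ?_⟩, ?_, ?_⟩
    · simp only [hp]; field_simp; ring
    · rintro ⟨⟨s, t⟩, hx⟩
      simp only [hp] at hx
      simp only [Subtype.mk.injEq, Prod.mk.injEq, and_true]
      rw [div_eq_iff hr]
      linear_combination -hx
    · intro t; rfl
  · refine Nat.card_congr ⟨fun x => x.1.1, fun s => ⟨(s, -(α + r * s) / p), ?_⟩, ?_, ?_⟩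
    · simp only; field_simp; ring
    · rintro ⟨⟨s, t⟩, hx⟩
      simp only at hx
      simp only [Subtype.mk.injEq, Prod.mk.injEq, true_and]
      rw [div_eq_iff hp]
      linear_combination -hx
    · intro t; rfl

theorem natCard_hyperbolic_quadric [CharP F 2] :
    Nat.card {x : (F × F) × (F × F) // x.1.1 ^ 2 + x.1.1 * x.1.2 + x.1.2 ^ 2 +
      (x.2.1 ^ 2 + x.2.1 * x.2.2 + x.2.2 ^ 2) = 0} + Nat.card F =
    Nat.card F ^ 3 + Nat.card F ^ 2 := by
  classical
  have := Fintype.ofFinite F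
  have h2 := CharTwo.two_eq_zero (R := F)
  -- The form is f(x) + f(z) for one binary form f. In characteristic 2, putting y = x + z turns it
  -- into f(y) + B(y, z), B being the polar form of f. For fixed y this is affine in z.
  let e : (F × F) × (F × F) ≃ (F × F) × (F × F) :=
    ⟨fun x => ((x.1.1 + x.2.1, x.1.2 + x.2.2), x.2),
      fun x => ((x.1.1 - x.2.1, x.1.2 - x.2.2), x.2), fun x => by simp, fun x => by simp⟩
  rw [Nat.card_congr (e.subtypeEquiv (q := fun x => (x.1.1 ^ 2 + x.1.1 * x.1.2 + x.1.2 ^ 2) +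
    x.1.1 * x.2.2 + x.1.2 * x.2.1 = 0) (fun x => by
      rcases x with ⟨⟨a, c⟩, s, t⟩
      have : ((a + s) ^ 2 + (a + s) * (c + t) + (c + t) ^ 2) + (a + s) * t + (c + t) * s =
        a ^ 2 + a * c + c ^ 2 + (s ^ 2 + s * t + t ^ 2) := by
          linear_combination (a * s + c * t + s * t + a * t + c * s) * h2
      simp only [e, Equiv.coe_fn_mk, this])),
    natCard_subtype_prod (fun (y z : F × F) => (y.1 ^ 2 + y.1 * y.2 + y.2 ^ 2) +
      y.1 * z.2 + y.2 * z.1 = 0)]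
  have hc : ∀ y : F × F, Nat.card {z : F × F // (y.1 ^ 2 + y.1 * y.2 + y.2 ^ 2) +
      y.1 * z.2 + y.2 * z.1 = 0} = if y = 0 then Nat.card F ^ 2 else Nat.card F := by
    intro y
    split_ifs with hy
    · subst hy
      simp [pow_two]
    · exact natCard_affine_line fun h => hy (Prod.ext h.1 h.2)
  simp only [hc]
  rw [← Finset.add_sum_erase _ _ (Finset.mem_univ (0 : F × F)), if_pos rfl,
    Finset.sum_congr rfl (fun y hy => if_neg (Finset.ne_of_mem_erase hy)), Finset.sum_const,
    Finset.card_erase_of_mem (Finset.mem_univ _), Finset.card_univ, Fintype.card_prod,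
    ← Nat.card_eq_fintype_card, smul_eq_mul]
  have hq : 0 < Nat.card F := Nat.card_pos
  obtain ⟨k, hk⟩ : ∃ k, Nat.card F * Nat.card F = k + 1 :=
    ⟨Nat.card F * Nat.card F - 1, by have := Nat.mul_pos hq hq; omega⟩
  rw [hk, Nat.add_sub_cancel]
  nlinarith

variable {L : Type*} [Field L] [Finite L] [Algebra F L]

theorem natCard_trace_eq_one [CharP F 2] (hL : Nat.card L = Nat.card F ^ 3) :
    Nat.card {g : L // Algebra.trace F L g = 1} = Nat.card F ^ 2 := by
  obtain ⟨φ, hφ⟩ := exists_frobenius_algHom F L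
  obtain ⟨e, he⟩ := exists_cubic_coordinates hφ hL
  rw [← Nat.card_congr (e.subtypeEquiv (p := fun x => x.1 = 1) (fun x => by
    rw [(he x.1 x.2.1 x.2.2).1])), pow_two, ← Nat.card_prod]
  exact Nat.card_congr ⟨fun x => x.1.2, fun y => ⟨(1, y), rfl⟩,
    fun x => Subtype.ext (Prod.ext x.2.symm rfl), fun y => rfl⟩

theorem natCard_trace_quadric [CharP F 2] {φ : L →ₐ[F] L}
    (hφ : ∀ x, φ x = x ^ Nat.card F) (hL : Nat.card L = Nat.card F ^ 3) :
    Nat.card {x : L × F // x.2 ^ 2 - Algebra.trace F L x.1 * x.2 + conjSymmTwo φ x.1 = 0} +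
      Nat.card F = Nat.card F ^ 3 + Nat.card F ^ 2 := by
  obtain ⟨e, he⟩ := exists_cubic_coordinates hφ hL
  have h2 := CharTwo.two_eq_zero (R := F)
  let e' : (F × F) × (F × F) ≃ L × F :=
    ⟨fun x => (e (x.1.2, x.2.1, x.2.2), x.1.1),
      fun y => ((y.2, (e.symm y.1).1), (e.symm y.1).2), fun x => by simp, fun y => by simp⟩
  rw [← natCard_hyperbolic_quadric (F := F), Nat.card_congr (e'.subtypeEquiv fun x => ?_)]
  simp only [e', Equiv.coe_fn_mk, he]
  rw [← sub_eq_zero, iff_iff_eq]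
  congr 1
  linear_combination x.1.1 * x.1.2 * h2

/-- Points of the cubic threefold away from its rational node, together with a scalar, correspond to
points off the tangent cone at the node. -/
theorem natCard_cubic_off_node (hL : Nat.card L = Nat.card F ^ 3) (φ : L →ₐ[F] L) :
    Nat.card {x : L × F // x.1 ≠ 0 ∧
        x.2 ^ 2 - Algebra.trace F L x.1 * x.2 + conjSymmTwo φ x.1 + Algebra.norm F x.1 = 0} *
      (Nat.card F - 1) =
    Nat.card {x : L × F // x.1 ≠ 0 ∧
        x.2 ^ 2 - Algebra.trace F L x.1 * x.2 + conjSymmTwo φ x.1 ≠ 0} := by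
  have : Module.Finite F L := Module.Finite.of_finite
  have hN : ∀ (r : F) (h : L), Algebra.norm F (r • h) = r ^ 3 * Algebra.norm F h := fun r h => by
    rw [Algebra.smul_def, map_mul, Algebra.norm_algebraMap, finrank_eq_of_card_eq_pow hL]
  have hN0 : ∀ {h : L}, h ≠ 0 → Algebra.norm F h ≠ 0 := Algebra.norm_ne_zero_iff.2
  let Q : L × F → F := fun x => x.2 ^ 2 - Algebra.trace F L x.1 * x.2 + conjSymmTwo φ x.1
  have hQ : ∀ (r : F) x, Q (r • x) = r ^ 2 * Q x := fun r x => by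
    simp only [Q, Prod.smul_fst, Prod.smul_snd, map_smul, conjSymmTwo_smul, smul_eq_mul]
    ring
  change Nat.card {x : L × F // x.1 ≠ 0 ∧ Q x + Algebra.norm F x.1 = 0} * _ =
    Nat.card {x : L × F // x.1 ≠ 0 ∧ Q x ≠ 0}
  rw [← Nat.card_units, ← Nat.card_prod]
  have hfix : ∀ {x : L × F}, x.1 ≠ 0 → Q x + Algebra.norm F x.1 = 0 → ∀ r : F, r ≠ 0 →
      -Q (r • x) / Algebra.norm F (r • x).1 = r⁻¹ := by
    intro x hx h r hr
    have := hN0 hx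
    rw [hQ, Prod.smul_fst, hN]
    field_simp
    linear_combination -h
  -- On the line through 0 and x the equation is r²Q(x) + r³N = 0, with N the norm of the first
  -- coordinate; its only nonzero solution is r = -Q(x)/N.
  refine Nat.card_congr ⟨fun y => ⟨(y.2 : F) • y.1.1, ?_, ?_⟩,
    fun x => (⟨(-Q x / Algebra.norm F x.1.1) • x.1, ?_, ?_⟩,
      Units.mk0 (-Q x / Algebra.norm F x.1.1)⁻¹
        (inv_ne_zero (div_ne_zero (neg_ne_zero.2 x.2.2) (hN0 x.2.1)))), ?_, ?_⟩
  · exact smul_ne_zero y.2.ne_zero y.1.2.1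
  · rw [hQ]
    refine mul_ne_zero (pow_ne_zero 2 y.2.ne_zero) fun h => hN0 y.1.2.1 ?_
    simpa [h] using y.1.2.2
  · exact smul_ne_zero (div_ne_zero (neg_ne_zero.2 x.2.2) (hN0 x.2.1)) x.2.1
  · have := hN0 x.2.1
    rw [hQ, Prod.smul_fst, hN]
    field_simp
    ring
  · rintro ⟨⟨x, hx, h⟩, r⟩
    have hr := hfix hx h r r.ne_zero
    refine Prod.ext (Subtype.ext ?_) (Units.ext ?_)
    · simp only [hr]
      rw [smul_smul, inv_mul_cancel₀ r.ne_zero, one_smul]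
    · simp only [hr, Units.val_mk0, inv_inv]
  · rintro ⟨x, hx, h⟩
    refine Subtype.ext ?_
    have : -Q x / Algebra.norm F x.1 ≠ 0 := div_ne_zero (neg_ne_zero.2 h) (hN0 hx)
    simp only [Units.val_mk0]
    rw [smul_smul, inv_mul_cancel₀ this, one_smul]

theorem natCard_subtype_eq_add {A : Type*} [Finite A] (P R : A → Prop) :
    Nat.card {x // P x} = Nat.card {x // R x ∧ P x} + Nat.card {x // ¬ R x ∧ P x} := by
  classical
  have := Fintype.ofFinite A
  simp only [Nat.card_eq_fintype_card, Fintype.card_subtype]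
  rw [← Finset.card_filter_add_card_filter_not (s := Finset.univ.filter P) R,
    Finset.filter_filter, Finset.filter_filter]
  simp only [and_comm]

/-- Away from the node the number of points is (q⁴ - (q³ + q² - q) - (q - 1))/(q - 1) = q³ - q - 1,
and the node adds one. -/
theorem natCard_cubic [CharP F 2] (hL : Nat.card L = Nat.card F ^ 3) :
    Nat.card {x : L × F // x.2 ^ 2 - (Algebra.trace F L x.1 - 1) * x.2 +
        Algebra.norm F x.1 = 0} + Nat.card F = Nat.card F ^ 3 := by
  obtain ⟨φ, hφ⟩ := exists_frobenius_algHom F L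
  have h2 := CharTwo.two_eq_zero (R := F)
  have hoff := natCard_cubic_off_node hL φ
  have hquad := natCard_trace_quadric hφ hL
  let Q : L × F → F := fun x => x.2 ^ 2 - Algebra.trace F L x.1 * x.2 + conjSymmTwo φ x.1
  have hQ0 : ∀ a : F, Q (0, a) = a ^ 2 := fun a => by simp [Q, conjSymmTwo]
  have hN0 : Algebra.norm F (0 : L) = 0 := by
    have : Module.Finite F L := Module.Finite.of_finite
    exact Algebra.norm_zero
  change Nat.card {x : L × F // x.1 ≠ 0 ∧ Q x + Algebra.norm F x.1 = 0} * _ =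
    Nat.card {x : L × F // x.1 ≠ 0 ∧ Q x ≠ 0} at hoff
  change Nat.card {x : L × F // Q x = 0} + _ = _ at hquad
  have hshift : Nat.card {x : L × F // x.2 ^ 2 - (Algebra.trace F L x.1 - 1) * x.2 +
      Algebra.norm F x.1 = 0} = Nat.card {x : L × F // Q x + Algebra.norm F x.1 = 0} := by
    -- Translating the node (1, 1) to the origin removes the constant and linear terms and leaves
    -- the quadratic form Q plus the cubic norm.
    refine (Nat.card_congr ((Equiv.addLeft ((1, 1) : L × F)).subtypeEquiv fun x => ?_)).symm
    simp only [Equiv.coe_addLeft, Prod.fst_add, Prod.snd_add, norm_one_add_cubic hφ hL, map_add,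
      trace_one_cubic hL, Q]
    rw [iff_iff_eq]
    congr 1
    ring
  have hnode : Nat.card {x : L × F // x.1 = 0 ∧ Q x + Algebra.norm F x.1 = 0} = 1 := by
    have hx : ∀ x : L × F, x.1 = 0 → Q x + Algebra.norm F x.1 = 0 → x = (0, 0) := by
      rintro ⟨h, a⟩ (rfl : h = 0) ha
      rw [hQ0, hN0, add_zero] at ha
      rw [pow_eq_zero_iff two_ne_zero |>.1 ha]
    rw [Nat.card_eq_one_iff_unique]
    exact ⟨⟨fun x y => Subtype.ext ((hx x.1 x.2.1 x.2.2).trans (hx y.1 y.2.1 y.2.2).symm)⟩,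
      ⟨⟨(0, 0), rfl, by simp [hQ0, hN0]⟩⟩⟩
  have hcone : Nat.card {x : L × F // x.1 = 0 ∧ Q x ≠ 0} = Nat.card F - 1 := by
    rw [← Nat.card_units, Nat.card_congr unitsEquivNeZero]
    refine Nat.card_congr ⟨fun x => ⟨x.1.2, fun h => x.2.2 ?_⟩,
      fun a => ⟨(0, a.1), rfl, by rw [hQ0]; exact pow_ne_zero 2 a.2⟩, ?_, fun a => rfl⟩
    · rw [show x.1 = (0, x.1.2) from Prod.ext x.2.1 rfl, hQ0, h]; ring
    · exact fun x => Subtype.ext (Prod.ext x.2.1.symm rfl)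
  have hsplit := natCard_subtype_eq_add (fun x : L × F => Q x + Algebra.norm F x.1 = 0)
    (fun x => x.1 = 0)
  have hsplit' := natCard_subtype_eq_add (fun x : L × F => Q x ≠ 0) (fun x => x.1 = 0)
  have hcompl := natCard_subtype_eq_add (fun _ : L × F => True) (fun x => Q x = 0)
  simp only [and_true] at hcompl
  rw [Nat.card_congr (Equiv.subtypeUnivEquiv fun _ => trivial), Nat.card_prod, hL] at hcompl
  rw [hnode] at hsplit
  rw [hcone] at hsplit'
  rw [hshift]
  have hq : 1 < Nat.card F := Finite.one_lt_card
  generalize Nat.card F = q at *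
  obtain ⟨k, rfl⟩ : ∃ k, q = k + 1 := ⟨q - 1, by omega⟩
  rw [Nat.add_sub_cancel] at *
  have hk : 0 < k := by omega
  simp only [ne_eq] at *
  apply Nat.eq_of_mul_eq_mul_right hk
  rw [hsplit, add_mul, add_mul, hoff]
  nlinarith

theorem natCard_roots_eq_one [CharP F 2] (n : F) : Nat.card {a : F // a ^ 2 + n = 0} = 1 := by
  obtain ⟨a, ha⟩ := FiniteField.isSquare_of_char_two (ringChar.eq F 2) (-n)
  rw [Nat.card_eq_one_iff_unique]
  refine ⟨⟨fun x y => Subtype.ext ?_⟩, ⟨⟨a, by linear_combination -ha⟩⟩⟩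
  rw [← CharTwo.sq_inj]
  linear_combination x.2 - y.2

theorem natCard_roots_eq_two [CharP F 2] {t n a : F} (ht : t ≠ 0) (ha : a ^ 2 - t * a + n = 0) :
    Nat.card {x : F // x ^ 2 - t * x + n = 0} = 2 := by
  have h2 := CharTwo.two_eq_zero (R := F)
  have hne : a ≠ t - a := fun h => ht (by linear_combination -h + a * h2)
  have hset : {x : F | x ^ 2 - t * x + n = 0} = {a, t - a} := by
    ext x
    simp only [Set.mem_ofPred_eq, Set.mem_insert_iff, Set.mem_singleton_iff]
    constructor
    · intro hx
      have : (x - a) * (x - (t - a)) = 0 := by linear_combination hx - ha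
      simpa only [mul_eq_zero, sub_eq_zero] using this
    · rintro (rfl | rfl)
      · exact ha
      · linear_combination ha
  exact (congrArg Set.ncard hset).trans (Set.ncard_pair hne)

theorem natCard_splitting [CharP F 2] (hL : Nat.card L = Nat.card F ^ 3) :
    2 * Nat.card {g : L // g ≠ 0 ∧ Algebra.trace F L g ≠ 1 ∧
      ∃ a : F, a ^ 2 - (Algebra.trace F L g - 1) * a + Algebra.norm F g = 0} +
      (Nat.card F ^ 2 + Nat.card F + 2) = Nat.card F ^ 3 := by
  classical
  have := Fintype.ofFinite L
  have hcub := natCard_cubic hL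
  let P : L → Prop := fun g => Algebra.trace F L g ≠ 1 ∧
    ∃ a : F, a ^ 2 - (Algebra.trace F L g - 1) * a + Algebra.norm F g = 0
  have hc : ∀ g : L, Nat.card {a : F // a ^ 2 - (Algebra.trace F L g - 1) * a +
      Algebra.norm F g = 0} =
      (if Algebra.trace F L g = 1 then 1 else 0) + 2 * (if P g then 1 else 0) := by
    intro g
    by_cases h1 : Algebra.trace F L g = 1
    · have hP : ¬ P g := fun h => h.1 h1
      simp [h1, hP, natCard_roots_eq_one]
    · by_cases hP : P g
      · obtain ⟨a, ha⟩ := hP.2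
        rw [if_neg h1, if_pos hP, natCard_roots_eq_two (sub_ne_zero.2 h1) ha]
      · rw [if_neg h1, if_neg hP]
        have : IsEmpty {a : F // a ^ 2 - (Algebra.trace F L g - 1) * a + Algebra.norm F g = 0} :=
          ⟨fun a => hP ⟨h1, a.1, a.2⟩⟩
        simp
  rw [natCard_subtype_prod (fun (g : L) (a : F) => a ^ 2 - (Algebra.trace F L g - 1) * a +
    Algebra.norm F g = 0)] at hcub
  simp only [hc] at hcub
  rw [Finset.sum_add_distrib, ← Finset.mul_sum, ← Finset.card_filter, ← Finset.card_filter,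
    ← Fintype.card_subtype, ← Fintype.card_subtype, ← Nat.card_eq_fintype_card,
    ← Nat.card_eq_fintype_card, natCard_trace_eq_one hL,
    natCard_subtype_eq_add P (fun g => g = 0)] at hcub
  -- g = 0 satisfies the root condition with a = 0 but is not of the form 1/(1 - N(b)). Removing it
  -- accounts for the -2.
  have hP0 : P 0 := by
    have : Module.Finite F L := Module.Finite.of_finite
    exact ⟨by simp, 0, by simp⟩
  have h0 : Nat.card {g : L // g = 0 ∧ P g} = 1 := by
    rw [Nat.card_eq_one_iff_unique]
    exact ⟨⟨fun x y => Subtype.ext (x.2.1.trans y.2.1.symm)⟩, ⟨⟨0, rfl, hP0⟩⟩⟩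
  rw [h0] at hcub
  change 2 * Nat.card {g : L // g ≠ 0 ∧ P g} + _ = _
  simp only [ne_eq]
  omega

end Counting

/-! ### Transfer of the count to Γ. -/

theorem normSetGamma_eq_image {F L K : Type*} [Field F] [Finite F] [Field L] [Finite L] [Field K]
    [Finite K] [Algebra F L] [Algebra L K] [Algebra F K] [IsScalarTower F L K] [CharP F 2]
    (hL : Nat.card L = Nat.card F ^ 3) (hK : Nat.card K = Nat.card F ^ 6) :
    normSetGamma F L K = (fun g : L => 1 - g⁻¹) '' {g : L | g ≠ 0 ∧ Algebra.trace F L g ≠ 1 ∧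
      ∃ a : F, a ^ 2 - (Algebra.trace F L g - 1) * a + Algebra.norm F g = 0} := by
  obtain ⟨σ, hσ⟩ := exists_frobenius_algHom F K
  ext w
  simp only [normSetGamma, Set.mem_ofPred_eq, Set.mem_image, isMaximumScattered_subspaceU_iff hσ,
    isScattered_subspaceU_iff_exists_root hL hK]
  constructor
  · rintro ⟨b, ⟨g, hg, h⟩, rfl⟩
    exact ⟨g, ⟨left_ne_zero_of_mul_eq_one hg, h⟩, by
      rw [← eq_inv_of_mul_eq_one_right hg]; ring⟩
  · rintro ⟨g, ⟨hg0, h⟩, rfl⟩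
    obtain ⟨b, hb⟩ := FiniteField.norm_surjective L K (1 - g⁻¹)
    exact ⟨b, ⟨g, by rw [hb, sub_sub_cancel, mul_inv_cancel₀ hg0], h⟩, hb⟩

theorem charP_two_of_even_card {F : Type*} [Field F] [Finite F] (h : Even (Nat.card F)) :
    CharP F 2 := by
  have := Fintype.ofFinite F
  rw [Nat.card_eq_fintype_card] at h
  exact ringChar.of_eq (FiniteField.even_card_iff_char_two.2 (Nat.even_iff.1 h))

theorem mainTheorem4 (q : ℕ) (hq : Even q)
    (F L K : Type*) [Field F] [Finite F] [Field L] [Field K]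
    [Algebra F L] [Algebra L K] [Algebra F K] [IsScalarTower F L K]
    (hF : Nat.card F = q) (hL : Nat.card L = q ^ 3) (hK : Nat.card K = q ^ 6) :
    ((normSetGamma F L K).ncard : ℚ) = ((q : ℚ) ^ 3 - (q : ℚ) ^ 2 - (q : ℚ) - 2) / 2 ∧
    ((normSetGamma F L K).ncard : ℤ) = ⌊((q : ℚ) ^ 2 + (q : ℚ) + 1) * ((q : ℚ) - 2) / 2⌋ := by
  subst hF
  have hpos : 0 < Nat.card F := Nat.card_pos
  have : Finite L := Nat.finite_of_card_ne_zero (by rw [hL]; positivity)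
  have : Finite K := Nat.finite_of_card_ne_zero (by rw [hK]; positivity)
  have := charP_two_of_even_card hq
  have hinj : Function.Injective fun g : L => 1 - g⁻¹ := fun x y h => by simpa using h
  have hcount := natCard_splitting hL
  rw [← Set.coe_ofPred, Nat.card_coe_set_eq, ← Set.ncard_image_of_injective _ hinj,
    ← normSetGamma_eq_image hL hK] at hcount
  have hcount' := congrArg (Nat.cast : ℕ → ℚ) hcount
  push_cast at hcount'
  refine ⟨by linear_combination hcount' / 2, ?_⟩
  -- (q² + q + 1)(q - 2) = q³ - q² - q - 2, so the floor is taken of an integer.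
  rw [eq_comm, Int.floor_eq_iff, Int.cast_natCast]
  constructor <;> linarith
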